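/- All graphs are finite and simple. Local complementation at a vertex $v$ of a graph $G$ replaces the subgraph induced on the neighbourhood of $v$ by its complement. A graph $H$ is a vertex-minor of $G$ if $H$ can be obtained (up to isomorphism) from $G$ by a sequence of vertex deletions and local complementations. A class of graphs is vertex-minor-closed if it contains every vertex-minor of each of its members, and it is proper if it does not contain all graphs. For a positive integer $\rho$, a $\rho$-ball of $G$ is the subgraph induced on a vertex $v$ together with all vertices at distance at most $\rho$ from $v$, and $\chi^{(\rho)}(G)$ is the maximum chromatic number of a $\rho$-ball of $G$ (with $\chi^{(\rho)}(G)=0$ if $G$ has no vertices). **Theorem.** Every proper vertex-minor-closed class of graphs is linearly $9$-controlled: for every proper vertex-minor-closed class $\mathcal{G}$ there is a constant $c$ such that $\chi(G)\le c\,\chi^{(9)}(G)$ for all $G\in\mathcal{G}$. -/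

import Mathlib

universe u

/-- A finite simple graph, bundled with its vertex set. -/
structure FiniteGraph : Type (u + 1) where
  /-- the vertex set -/
  V : Type u
  [finite : Finite V]
  /-- the adjacency structure -/
  graph : SimpleGraph V

attribute [instance] FiniteGraph.finite

namespace FiniteGraph

/-- Deletion of a single vertex `v`. -/
def deleteVertex (G : FiniteGraph.{u}) (v : G.V) : FiniteGraph.{u} where
  V := {w : G.V // w ≠ v}
  graph := G.graph.induce {w : G.V | w ≠ v}

/-- Local complementation `G * v`: the subgraph induced on the neighbourhood of `v` is replaced
by its complement, so the adjacency of two distinct vertices `a`, `b` is switched exactly when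
both are neighbours of `v`. -/
def localComplement (G : FiniteGraph.{u}) (v : G.V) : FiniteGraph.{u} where
  V := G.V
  graph :=
    { Adj := fun a b => a ≠ b ∧ Xor (G.graph.Adj a b) (G.graph.Adj v a ∧ G.graph.Adj v b)
      symm := ⟨fun a b h => by
        rw [G.graph.adj_comm b a, and_comm (a := G.graph.Adj v b)]
        exact ⟨h.1.symm, h.2⟩⟩
      loopless := ⟨fun _ h => h.1 rfl⟩ }

/-- `IsVertexMinor G H`: the graph `H` is a vertex-minor of `G`, that is, `H` is obtained from `G`
by a finite sequence of vertex deletions and local complementations (up to isomorphism). -/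
inductive IsVertexMinor (G : FiniteGraph.{u}) : FiniteGraph.{u} → Prop
  | refl : IsVertexMinor G G
  | delete {H : FiniteGraph.{u}} (h : IsVertexMinor G H) (v : H.V) :
      IsVertexMinor G (H.deleteVertex v)
  | localComplement {H : FiniteGraph.{u}} (h : IsVertexMinor G H) (v : H.V) :
      IsVertexMinor G (H.localComplement v)
  | iso {H K : FiniteGraph.{u}} (h : IsVertexMinor G H) (e : H.graph ≃g K.graph) :
      IsVertexMinor G K

/-- The chromatic number `χ(G)`. -/
noncomputable def chi (G : FiniteGraph.{u}) : ℕ∞ := G.graph.chromaticNumber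

/-- The vertex set of the `ρ`-ball around `v`: the vertices at distance at most `ρ` from `v`.
The extended distance is infinite between different components. -/
def ballSet (G : FiniteGraph.{u}) (ρ : ℕ) (v : G.V) : Set G.V :=
  {w | G.graph.edist v w ≤ (ρ : ℕ∞)}

/-- `χ^{(ρ)}(G)`: the maximum chromatic number of a `ρ`-ball of `G` (it is `0` for the graph
without vertices). -/
noncomputable def ballChi (G : FiniteGraph.{u}) (ρ : ℕ) : ℕ∞ :=
  ⨆ v : G.V, (G.graph.induce (G.ballSet ρ v)).chromaticNumber

/-- A class of graphs is vertex-minor-closed if it contains every vertex-minor of each of its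
members (in particular it is closed under isomorphism). -/
def VertexMinorClosed (𝒢 : Set FiniteGraph.{u}) : Prop :=
  ∀ G ∈ 𝒢, ∀ H : FiniteGraph.{u}, IsVertexMinor G H → H ∈ 𝒢

/-- A class of graphs is proper if it does not contain all graphs. -/
def Proper (𝒢 : Set FiniteGraph.{u}) : Prop :=
  ∃ H : FiniteGraph.{u}, H ∉ 𝒢

/-- A class of graphs is linearly `ρ`-controlled if there is a constant `c` such that
`χ(G) ≤ c χ^{(ρ)}(G)` for every graph `G` in the class. -/
def LinearlyControlled (ρ : ℕ) (𝒢 : Set FiniteGraph.{u}) : Prop :=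
  ∃ c : ℕ, ∀ G ∈ 𝒢, G.chi ≤ (c : ℕ∞) * G.ballChi ρ

end FiniteGraph

/-! Let `Γ` be a graph on `r` vertices outside the class. If the chromatic number of `G` exceeds a
constant, depending only on `Γ`, times that of its balls, then local complementations turn some `r`
vertices of `G` (the columns) into an induced copy of `Γ`, a contradiction.

Algebra: the edges among the columns form a vector over the field with two elements, indexed by
pairs. Take a connected set, a hub, containing for each column a vertex whose only neighbour among
the columns is that one. The changes produced by local complementations inside the hub span the
whole space (`span_switches_eq_top`). Given as many pairwise anticomplete hubs as the dimension, one
change per hub can be chosen so that together they form a basis. Changes in different hubs do not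
interfere, so every sub-sum of this basis, hence every graph on the columns, is attained
(`exists_localCompls_adj_iff`).

Geometry: some distance layer keeps half of the chromatic number, and the vertices at least two
layers closer to the root form a connected hub anticomplete to it. Iterating inside the layer gives
many hubs and a set `T` of large chromatic number, each vertex of which is joined to every hub
through one further vertex (`exists_isHubSystem`). In `T` there are many vertices pairwise far apart
(`exists_far_vertices`). Pigeonhole and Ramsey make their attachments uniform, and the columns are
either joining vertices of a single hub or the far vertices themselves
(`IsHubSystem.exists_localCompls`). -/

namespace SimpleGraph

/-! ### Local complementation over the field with two elements, and induced paths -/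

variable {V : Type*}

/-- Local complementation at a vertex. -/
def localCompl (G : SimpleGraph V) (v : V) : SimpleGraph V where
  Adj a b := a ≠ b ∧ Xor (G.Adj a b) (G.Adj v a ∧ G.Adj v b)
  symm := ⟨fun a b h => by
    rw [G.adj_comm b a, and_comm (a := G.Adj v b)]
    exact ⟨h.1.symm, h.2⟩⟩
  loopless := ⟨fun _ h => h.1 rfl⟩

/-- Successive local complementation at the vertices of a list. -/
def localCompls (G : SimpleGraph V) (l : List V) : SimpleGraph V :=
  l.foldl localCompl G

@[simp] lemma localCompls_nil (G : SimpleGraph V) : G.localCompls [] = G := rfl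

@[simp] lemma localCompls_cons (G : SimpleGraph V) (v : V) (l : List V) :
    G.localCompls (v :: l) = (G.localCompl v).localCompls l := rfl

lemma localCompls_append (G : SimpleGraph V) (l l' : List V) :
    G.localCompls (l ++ l') = (G.localCompls l).localCompls l' :=
  List.foldl_append

open Classical in
/-- The entries of the adjacency matrix over the field with two elements. -/
noncomputable def adjF2 (G : SimpleGraph V) (a b : V) : ZMod 2 := if G.Adj a b then 1 else 0

lemma adjF2_of_adj {G : SimpleGraph V} {a b : V} (h : G.Adj a b) : G.adjF2 a b = 1 := by
  simp [adjF2, h]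

lemma adjF2_of_not_adj {G : SimpleGraph V} {a b : V} (h : ¬ G.Adj a b) : G.adjF2 a b = 0 := by
  simp [adjF2, h]

lemma adjF2_eq_one {G : SimpleGraph V} {a b : V} : G.adjF2 a b = 1 ↔ G.Adj a b := by
  by_cases h : G.Adj a b <;> simp [adjF2, h]

lemma adjF2_eq_zero {G : SimpleGraph V} {a b : V} : G.adjF2 a b = 0 ↔ ¬ G.Adj a b := by
  by_cases h : G.Adj a b <;> simp [adjF2, h]

lemma adjF2_self (G : SimpleGraph V) (a : V) : G.adjF2 a a = 0 := by
  simp [adjF2]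

lemma adjF2_localCompl (G : SimpleGraph V) (v : V) {a b : V} (h : a ≠ b) :
    (G.localCompl v).adjF2 a b = G.adjF2 a b + G.adjF2 v a * G.adjF2 v b := by
  by_cases h1 : G.Adj a b <;> by_cases h2 : G.Adj v a <;> by_cases h3 : G.Adj v b <;>
    simp [adjF2, localCompl, Xor, h, h1, h2, h3]
  decide

/-- The restriction of a graph to the edges inside a set. -/
def restrict (G : SimpleGraph V) (C : Set V) : SimpleGraph V where
  Adj a b := G.Adj a b ∧ a ∈ C ∧ b ∈ C
  symm := ⟨fun _ _ h => ⟨h.1.symm, h.2.2, h.2.1⟩⟩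
  loopless := ⟨fun _ h => h.1.ne rfl⟩

lemma exists_adj_of_dist_eq_succ {G : SimpleGraph V} {u w : V} {n : ℕ} (hr : G.Reachable u w)
    (hd : G.dist u w = n + 1) : ∃ y, G.Adj y w ∧ G.Reachable u y ∧ G.dist u y = n := by
  obtain ⟨p, hp⟩ := hr.symm.exists_walk_length_eq_dist
  rw [G.dist_comm, hd] at hp
  cases p with
  | nil => simp at hp
  | @cons _ y _ h q =>
    refine ⟨y, h.symm, q.reachable.symm, ?_⟩
    have h1 : G.dist u y ≤ n := by
      rw [G.dist_comm]
      have := dist_le q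
      simp at hp
      omega
    have h2 : G.dist u w ≤ G.dist u y + 1 := by
      obtain ⟨q', hq'⟩ := q.reachable.symm.exists_walk_length_eq_dist
      have := dist_le (q'.concat h.symm)
      rw [Walk.length_concat] at this
      omega
    omega

lemma dist_le_dist_add_one {G : SimpleGraph V} {u x y : V} (hr : G.Reachable u x)
    (h : G.Adj x y) : G.dist u y ≤ G.dist u x + 1 := by
  obtain ⟨q, hq⟩ := hr.exists_walk_length_eq_dist
  have := dist_le (q.concat h)
  rw [Walk.length_concat] at this
  omega

/-- A sequence of vertices, up to index `n`, that is an induced path of `G`. -/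
def IsInducedPath (G : SimpleGraph V) (n : ℕ) (c : ℕ → V) : Prop :=
  ∀ i j, i < j → j ≤ n → c i ≠ c j ∧ (G.Adj (c i) (c j) ↔ j = i + 1)

lemma exists_geodesic {G : SimpleGraph V} {u : V} (n : ℕ) : ∀ {w : V}, G.Reachable u w →
    G.dist u w = n → ∃ c : ℕ → V, c 0 = u ∧ c n = w ∧
      (∀ i ≤ n, G.Reachable u (c i) ∧ G.dist u (c i) = i) ∧ ∀ i < n, G.Adj (c i) (c (i + 1)) := by
  induction n with
  | zero =>
    intro w hr hd
    have := hr.dist_eq_zero_iff.1 hd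
    subst this
    exact ⟨fun _ => u, rfl, rfl, fun i hi => ⟨hr, by simp_all⟩, fun i hi => by omega⟩
  | succ n ih =>
    intro w hr hd
    obtain ⟨y, hy, hry, hdy⟩ := exists_adj_of_dist_eq_succ hr hd
    obtain ⟨c, h0, hn, h1, h2⟩ := ih hry hdy
    refine ⟨fun i => if i ≤ n then c i else w, by simp [h0], by simp, ?_, ?_⟩
    · intro i hi
      by_cases h : i ≤ n
      · simpa [h] using h1 i h
      · obtain rfl : i = n + 1 := by omega
        simpa using ⟨hr, hd⟩
    · intro i hi
      by_cases h : i + 1 ≤ n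
      · have h' : i ≤ n := by omega
        simpa [h, h'] using h2 i h
      · obtain rfl : i = n := by omega
        simpa [hn] using hy

/-- A geodesic of `G.restrict C` has no chords in `G`, since a chord would join two vertices of `C`
and shorten it. -/
lemma exists_inducedPath {G : SimpleGraph V} {C : Set V} {u w : V} (hu : u ∈ C)
    (h : (G.restrict C).Reachable u w) :
    ∃ (n : ℕ) (c : ℕ → V), c 0 = u ∧ c n = w ∧ (∀ i ≤ n, c i ∈ C) ∧ G.IsInducedPath n c := by
  obtain ⟨c, h0, hn, h1, h2⟩ := exists_geodesic _ h rfl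
  have hC : ∀ i ≤ (G.restrict C).dist u w, c i ∈ C := by
    intro i hi
    rcases i with _ | i
    · rwa [h0]
    · exact (h2 i hi).2.2
  refine ⟨_, c, h0, hn, hC, fun i j hij hj => ⟨?_, ?_, ?_⟩⟩
  · intro he
    have a := (h1 i (by omega)).2
    have b := (h1 j hj).2
    rw [he] at a
    omega
  · intro ha
    have := dist_le_dist_add_one (h1 i (by omega)).1
      (show (G.restrict C).Adj (c i) (c j) from ⟨ha, hC i (by omega), hC j hj⟩)
    rw [(h1 i (by omega)).2, (h1 j hj).2] at this
    omega
  · rintro rfl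
    exact (h2 i (by omega)).1

end SimpleGraph

/-! ### The changes one connected hub can effect -/

namespace SimpleGraph

variable {V ι : Type*}

/-- The adjacencies of `v` to the vertices `col i`. -/
noncomputable def rowOn (G : SimpleGraph V) (col : ι → V) (v : V) : ι → ZMod 2 :=
  fun i => G.adjF2 v (col i)

lemma rowOn_localCompl {G : SimpleGraph V} {col : ι → V} (v : V) {u : V} (hu : ∀ i, u ≠ col i) :
    (G.localCompl v).rowOn col u = G.rowOn col u + G.adjF2 v u • G.rowOn col v := by
  funext i
  exact adjF2_localCompl G v (hu i)

variable [LinearOrder ι]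

/-- Functions on the unordered pairs of distinct elements of `ι`. -/
abbrev PairSpace (ι : Type*) [LinearOrder ι] : Type _ := {q : ι × ι // q.1 < q.2} → ZMod 2

/-- The alternating product of two vectors, as a function on pairs. -/
def pairing (x y : ι → ZMod 2) : PairSpace ι :=
  fun q => x q.1.1 * y q.1.2 + x q.1.2 * y q.1.1

/-- The indicator of the pairs inside the support of `x`. -/
def pairSquare (x : ι → ZMod 2) : PairSpace ι := fun q => x q.1.1 * x q.1.2

lemma pairSquare_add (x y : ι → ZMod 2) :
    pairSquare (x + y) = pairSquare x + pairSquare y + pairing x y := by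
  funext q
  simp only [pairSquare, pairing, Pi.add_apply]
  ring

lemma pairing_add_left (x x' y : ι → ZMod 2) :
    pairing (x + x') y = pairing x y + pairing x' y := by
  funext q
  simp only [pairing, Pi.add_apply]
  ring

lemma pairing_add_right (x y y' : ι → ZMod 2) :
    pairing x (y + y') = pairing x y + pairing x y' := by
  funext q
  simp only [pairing, Pi.add_apply]
  ring

lemma pairing_self (x : ι → ZMod 2) : pairing x x = 0 := by
  funext q
  simp only [pairing, mul_comm (x q.1.2), CharTwo.add_self_eq_zero, Pi.zero_apply]

/-- The adjacencies among the vertices `col i`. -/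
noncomputable def pairTrace (G : SimpleGraph V) (col : ι → V) : PairSpace ι :=
  fun q => G.adjF2 (col q.1.1) (col q.1.2)

/-- The changes of adjacency among the vertices `col i` that local complementations inside `C`
can effect. -/
def switches (G : SimpleGraph V) (col : ι → V) (C : Set V) : Set (PairSpace ι) :=
  {e | ∃ l : List V, (∀ v ∈ l, v ∈ C) ∧
    e = (G.localCompls l).pairTrace col - G.pairTrace col}

variable {G : SimpleGraph V} {col : ι → V} {C : Set V}

lemma pairTrace_localCompl (hcol : Function.Injective col) (v : V) :
    (G.localCompl v).pairTrace col = G.pairTrace col + pairSquare (G.rowOn col v) := by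
  funext q
  exact adjF2_localCompl G v (hcol.ne q.2.ne)

lemma zero_mem_switches : (0 : PairSpace ι) ∈ G.switches col C :=
  ⟨[], by simp, by simp⟩

/-- A change of `G.localCompl v` along `l` is the difference of the changes of `G` along `v :: l`
and `[v]`. This is why spans are compared, not the sets themselves. -/
lemma span_switches_localCompl_le {v : V} (hv : v ∈ C) :
    Submodule.span (ZMod 2) ((G.localCompl v).switches col C) ≤
      Submodule.span (ZMod 2) (G.switches col C) := by
  rw [Submodule.span_le]
  rintro e ⟨l, hl, rfl⟩
  have h1 : (G.localCompls (v :: l)).pairTrace col - G.pairTrace col ∈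
      Submodule.span (ZMod 2) (G.switches col C) :=
    Submodule.subset_span ⟨v :: l, by simpa [hv] using hl, rfl⟩
  have h2 : (G.localCompls [v]).pairTrace col - G.pairTrace col ∈
      Submodule.span (ZMod 2) (G.switches col C) :=
    Submodule.subset_span ⟨[v], by simpa using hv, rfl⟩
  have := Submodule.sub_mem _ h1 h2
  simpa using this

lemma pairSquare_mem_span_switches (hcol : Function.Injective col) {v : V} (hv : v ∈ C) :
    pairSquare (G.rowOn col v) ∈ Submodule.span (ZMod 2) (G.switches col C) := by
  refine Submodule.subset_span ⟨[v], by simpa using hv, ?_⟩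
  simp [pairTrace_localCompl hcol]

/-- Polarization: after complementing at `v`, the row of `u` is the sum of both rows, and the square
of a sum differs from the sum of the squares by the pairing. -/
lemma pairing_mem_span_switches_of_adj (hcol : Function.Injective col)
    (hC : ∀ u ∈ C, ∀ i, u ≠ col i) {u v : V} (hu : u ∈ C) (hv : v ∈ C) (h : G.Adj v u) :
    pairing (G.rowOn col u) (G.rowOn col v) ∈ Submodule.span (ZMod 2) (G.switches col C) := by
  have h1 := span_switches_localCompl_le (G := G) (col := col) hv
    (pairSquare_mem_span_switches (G := G.localCompl v) hcol hu)
  rw [rowOn_localCompl v (hC u hu), adjF2_of_adj h, one_smul, pairSquare_add] at h1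
  have h2 := pairSquare_mem_span_switches (G := G) hcol hu
  have h3 := pairSquare_mem_span_switches (G := G) hcol hv
  exact (Submodule.add_mem_iff_right _ (Submodule.add_mem _ h2 h3)).1 h1

lemma IsInducedPath.tail {n : ℕ} {c : ℕ → V} (h : G.IsInducedPath (n + 1) c) :
    G.IsInducedPath n (fun i => c (i + 1)) := by
  intro i j hij hj
  have := h (i + 1) (j + 1) (by omega) (by omega)
  simpa using this

/-- Local complementation at the second vertex of an induced path shortcuts the path. -/
lemma IsInducedPath.shortcut {n : ℕ} {c : ℕ → V} (h : G.IsInducedPath (n + 2) c) :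
    (G.localCompl (c 1)).IsInducedPath (n + 1) (fun i => if i = 0 then c 0 else c (i + 1)) := by
  intro i j hij hj
  have hj0 : j ≠ 0 := by omega
  -- On the path, `c 1` has only the neighbours `c 0` and `c 2`, so the single pair switched is the
  -- one that becomes the shortcut.
  rcases i with _ | i
  · have h1 := h 0 (j + 1) (by omega) (by omega)
    have h2 := h 0 1 (by omega) (by omega)
    have h3 := h 1 (j + 1) (by omega) (by omega)
    simp only [hj0, if_true, if_false, localCompl]
    refine ⟨h1.1, ?_⟩
    rw [h1.2, h3.2, G.adj_comm, h2.2]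
    simp [h1.1, Xor, hj0]
  · have h1 := h (i + 2) (j + 1) (by omega) (by omega)
    have h3 := h 1 (j + 1) (by omega) (by omega)
    simp only [hj0, if_false, localCompl, Nat.add_eq_zero_iff, one_ne_zero, and_false]
    refine ⟨h1.1, ?_⟩
    rw [h1.2, h3.2]
    have : ¬ (j + 1 = 1 + 1) := by omega
    simp [h1.1, Xor, this]

/-- Induction on the length: the tail pairs `c 1` with the end, and the shortcut path pairs `c 0 + c
1` (as rows) with the possibly modified end. Bilinearity isolates the pairing of `c 0` with the end.
-/
lemma pairing_mem_span_switches_of_inducedPath (hcol : Function.Injective col)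
    (hC : ∀ u ∈ C, ∀ i, u ≠ col i) (n : ℕ) : ∀ (G : SimpleGraph V) (c : ℕ → V),
    (∀ i ≤ n, c i ∈ C) → G.IsInducedPath n c →
    pairing (G.rowOn col (c 0)) (G.rowOn col (c n)) ∈
      Submodule.span (ZMod 2) (G.switches col C) := by
  induction n with
  | zero =>
    intro G c _ _
    rw [pairing_self]
    exact Submodule.zero_mem _
  | succ n ih =>
    intro G c hc hp
    rcases n with _ | n
    · exact pairing_mem_span_switches_of_adj hcol hC (hc 0 (by omega)) (hc 1 (by omega))
        (((hp 0 1 (by omega) (by omega)).2.2 rfl).symm)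
    · have h1C := hc 1 (by omega)
      have h01 : G.Adj (c 1) (c 0) := ((hp 0 1 (by omega) (by omega)).2.2 rfl).symm
      have h1 := ih G (fun i => c (i + 1)) (fun i hi => hc _ (by omega)) hp.tail
      have h2 := span_switches_localCompl_le (G := G) (col := col) h1C
        (ih (G.localCompl (c 1)) _ (fun i hi => by
          split_ifs
          · exact hc 0 (by omega)
          · exact hc _ (by omega)) hp.shortcut)
      have h3 := pairing_mem_span_switches_of_adj (G := G) hcol hC (hc 0 (by omega)) h1C h01
      simp only [if_true, Nat.add_eq_zero_iff, one_ne_zero, and_false, if_false] at h2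
      rw [rowOn_localCompl _ (hC _ (hc 0 (by omega))),
        rowOn_localCompl _ (hC _ (hc (n + 1 + 1) (by omega))), adjF2_of_adj h01, one_smul,
        pairing_add_left, pairing_add_right, pairing_add_right] at h2
      -- The coefficient `e` records whether `c 1` is adjacent to the end, which happens only on a
      -- path of length two; both values are treated at once.
      have key : ∀ e : ZMod 2, pairing (G.rowOn col (c 0)) (e • G.rowOn col (c 1)) ∈
            Submodule.span (ZMod 2) (G.switches col C) ∧
          pairing (G.rowOn col (c 1)) (e • G.rowOn col (c 1)) = 0 := by
        intro e
        obtain rfl | rfl : e = 0 ∨ e = 1 := by revert e; decide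
        · constructor
          · have : pairing (G.rowOn col (c 0)) ((0 : ZMod 2) • G.rowOn col (c 1)) = 0 := by
              funext q; simp [pairing]
            rw [this]
            exact Submodule.zero_mem _
          · funext q; simp [pairing]
        · rw [one_smul]
          exact ⟨h3, pairing_self _⟩
      obtain ⟨k1, k2⟩ := key (G.adjF2 (c 1) (c (n + 1 + 1)))
      rw [k2, add_zero] at h2
      exact (Submodule.add_mem_iff_left _ k1).1 ((Submodule.add_mem_iff_left _ h1).1 h2)

lemma span_switches_eq_top [Finite ι] (hcol : Function.Injective col)
    (hC : ∀ u ∈ C, ∀ i, u ≠ col i)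
    (hconn : ∀ u ∈ C, ∀ w ∈ C, (G.restrict C).Reachable u w)
    (hrow : ∀ i, ∃ u ∈ C, ∀ j, G.Adj u (col j) ↔ j = i) :
    Submodule.span (ZMod 2) (G.switches col C) = ⊤ := by
  classical
  have := Fintype.ofFinite ι
  rw [eq_top_iff, ← (Pi.basisFun (ZMod 2) {q : ι × ι // q.1 < q.2}).span_eq, Submodule.span_le]
  rintro _ ⟨q, rfl⟩
  obtain ⟨u, hu, hur⟩ := hrow q.1.1
  obtain ⟨w, hw, hwr⟩ := hrow q.1.2
  obtain ⟨n, c, rfl, rfl, hc, hp⟩ := exists_inducedPath hu (hconn u hu w hw)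
  have := pairing_mem_span_switches_of_inducedPath hcol hC n G c hc hp
  rw [SetLike.mem_coe]
  -- The rows of the two path ends are unit vectors, so their pairing is the basis vector of the
  -- pair `q`.
  convert this using 1
  funext p
  obtain ⟨⟨a, b⟩, hab⟩ := p
  obtain ⟨⟨s, t⟩, hst⟩ := q
  simp only at hab hst hur hwr
  simp only [Pi.basisFun_apply, pairing, rowOn, adjF2, hur, hwr, Pi.single_apply, Subtype.mk.injEq,
    Prod.mk.injEq]
  by_cases h1 : a = s <;> by_cases h2 : b = t <;> by_cases h3 : b = s <;> by_cases h4 : a = t <;>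
    simp_all
  exact absurd hab (lt_asymm hst)

end SimpleGraph

/-! ### Combining independent changes from anticomplete hubs -/

namespace SimpleGraph

section Transversal

variable {K M : Type*} [Field K] [AddCommGroup M] [Module K M]

lemma exists_linearIndependent_transversal (n : ℕ) (hn : n ≤ Module.finrank K M) :
    ∀ F : Fin n → Set M, (∀ i, Submodule.span K (F i) = ⊤) →
      ∃ f : Fin n → M, LinearIndependent K f ∧ ∀ i, f i ∈ F i := by
  induction n with
  | zero => exact fun F _ => ⟨Fin.elim0, linearIndependent_empty_type, fun i => i.elim0⟩
  | succ n ih =>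
    intro F hF
    obtain ⟨f, hf, hfF⟩ := ih (by omega) (fun i => F i.succ) (fun i => hF _)
    -- Fewer vectors than the dimension cannot span, while `F 0` does.
    have hne : ¬ F 0 ⊆ Submodule.span K (Set.range f) := by
      intro h
      rw [← Submodule.span_le, hF 0, top_le_iff] at h
      have := finrank_span_eq_card hf
      rw [h, finrank_top, Fintype.card_fin] at this
      omega
    obtain ⟨x, hx, hxf⟩ := Set.not_subset.1 hne
    refine ⟨Fin.cons x f, linearIndependent_finCons.2 ⟨hf, hxf⟩, fun i => ?_⟩
    induction i using Fin.cases with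
    | zero => simpa using hx
    | succ i => simpa using hfF i

/-- A full transversal is a basis, and the coefficients of `x` are 0 or 1. A coefficient 0 amounts
to choosing the zero element of that `F i`. -/
lemma exists_sum_transversal {M : Type*} [AddCommGroup M] [Module (ZMod 2) M]
    [FiniteDimensional (ZMod 2) M] (F : Fin (Module.finrank (ZMod 2) M) → Set M)
    (hF : ∀ i, Submodule.span (ZMod 2) (F i) = ⊤) (h0 : ∀ i, 0 ∈ F i) (x : M) :
    ∃ f : Fin (Module.finrank (ZMod 2) M) → M, (∀ i, f i ∈ F i) ∧ ∑ i, f i = x := by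
  obtain ⟨f, hf, hfF⟩ := exists_linearIndependent_transversal _ le_rfl F hF
  have hx : x ∈ Submodule.span (ZMod 2) (Set.range f) := by
    rw [hf.span_eq_top_of_card_eq_finrank' (by simp)]
    trivial
  obtain ⟨c, rfl⟩ := (Submodule.mem_span_range_iff_exists_fun _).1 hx
  refine ⟨fun i => c i • f i, fun i => ?_, rfl⟩
  have h2 : ∀ e : ZMod 2, e = 0 ∨ e = 1 := by decide
  rcases h2 (c i) with h | h
  · simpa [h] using h0 i
  · simpa [h] using hfF i

end Transversal

variable {V ι : Type*} [LinearOrder ι] {col : ι → V}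

/-- Each step adds the square of a row of a vertex of `C`, and agreement of the rows of `C` survives
local complementation inside `C`. -/
lemma pairTrace_localCompls_congr (hcol : Function.Injective col) {C : Set V} (l : List V) :
    ∀ {G G' : SimpleGraph V}, (∀ v ∈ l, v ∈ C) → (∀ x ∈ C, ∀ y, G.adjF2 x y = G'.adjF2 x y) →
      (G.localCompls l).pairTrace col - G.pairTrace col =
        (G'.localCompls l).pairTrace col - G'.pairTrace col := by
  induction l with
  | nil => intros; simp
  | cons v l ih =>
    intro G G' hl h
    have hv : v ∈ C := hl v (by simp)
    have h1 := ih (G := G.localCompl v) (G' := G'.localCompl v)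
      (fun w hw => hl w (by simp [hw])) (fun x hx y => by
        by_cases hxy : x = y
        · simp [hxy, adjF2_self]
        · rw [adjF2_localCompl _ _ hxy, adjF2_localCompl _ _ hxy, h x hx, h v hv, h v hv])
    have h2 : G.rowOn col v = G'.rowOn col v := funext fun i => h v hv _
    rw [pairTrace_localCompl hcol, pairTrace_localCompl hcol, h2, ← sub_sub, ← sub_sub] at h1
    exact sub_left_inj.1 h1

/-- Complementing at `v` alters only edges between neighbours of `v`, none of which lie in `D`. The
rows of `D` are thus fixed, so the hypothesis persists along the list. -/
lemma localCompls_adj_of_anticomplete {D : Set V} (l : List V) :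
    ∀ {G : SimpleGraph V}, (∀ v ∈ l, ∀ x ∈ D, ¬ G.Adj v x) →
      ∀ x ∈ D, ∀ y, (G.localCompls l).Adj x y ↔ G.Adj x y := by
  induction l with
  | nil => intros; simp
  | cons v l ih =>
    intro G h x hx y
    have hrow : ∀ x ∈ D, ∀ y, (G.localCompl v).Adj x y ↔ G.Adj x y := by
      intro x hx y
      have hvx := h v (by simp) x hx
      have hne : G.Adj x y → x ≠ y := fun h => h.ne
      simp only [localCompl, Xor, hvx, false_and]
      tauto
    rw [localCompls_cons, ih _ x hx y, hrow x hx y]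
    intro w hw x hx
    rw [adj_comm, hrow x hx, adj_comm]
    exact h w (by simp [hw]) x hx

lemma exists_localCompls_of_switches {κ : Type*} {G : SimpleGraph V}
    (hcol : Function.Injective col) (hub : κ → Set V)
    (hanti : ∀ i k, i ≠ k → ∀ u ∈ hub i, ∀ w ∈ hub k, ¬ G.Adj u w)
    (f : κ → PairSpace ι) (hf : ∀ i, f i ∈ G.switches col (hub i)) (s : Finset κ) :
    ∃ l : List V, (∀ v ∈ l, ∃ i ∈ s, v ∈ hub i) ∧
      (G.localCompls l).pairTrace col - G.pairTrace col = ∑ i ∈ s, f i := by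
  classical
  induction s using Finset.induction_on with
  | empty => exact ⟨[], by simp, by simp⟩
  | insert k s hk ih =>
    obtain ⟨l, hl, hsum⟩ := ih
    obtain ⟨l', hl', hf'⟩ := hf k
    refine ⟨l ++ l', ?_, ?_⟩
    · intro v hv
      rcases List.mem_append.1 hv with hv | hv
      · obtain ⟨i, hi, hvi⟩ := hl v hv
        exact ⟨i, Finset.mem_insert_of_mem hi, hvi⟩
      · exact ⟨k, Finset.mem_insert_self _ _, hl' v hv⟩
    · have hrows := localCompls_adj_of_anticomplete (D := hub k) l (G := G) (fun v hv x hx => by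
        obtain ⟨i, hi, hvi⟩ := hl v hv
        exact hanti i k (fun h => hk (h ▸ hi)) v hvi x hx)
      have := pairTrace_localCompls_congr hcol (C := hub k) l' (G := G.localCompls l) (G' := G) hl'
        (fun x hx y => by simp only [adjF2, hrows x hx y])
      rw [Finset.sum_insert hk, ← hsum, hf', ← this, localCompls_append]
      abel

/-- Sufficiently many pairwise anticomplete connected hubs, each attached to every column by a
private vertex, allow to create any graph on the columns by local complementations. -/
theorem exists_localCompls_adj_iff [Finite ι] {G : SimpleGraph V} (hcol : Function.Injective col)
    (hub : Fin (Module.finrank (ZMod 2) (PairSpace ι)) → Set V)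
    (hanti : ∀ i k, i ≠ k → ∀ u ∈ hub i, ∀ w ∈ hub k, ¬ G.Adj u w)
    (hC : ∀ i, ∀ u ∈ hub i, ∀ a, u ≠ col a)
    (hconn : ∀ i, ∀ u ∈ hub i, ∀ w ∈ hub i, (G.restrict (hub i)).Reachable u w)
    (hrow : ∀ i a, ∃ u ∈ hub i, ∀ b, G.Adj u (col b) ↔ b = a) (Γ : SimpleGraph ι) :
    ∃ l : List V, ∀ a b, (G.localCompls l).Adj (col a) (col b) ↔ Γ.Adj a b := by
  have := Fintype.ofFinite ι
  obtain ⟨f, hf, hsum⟩ := exists_sum_transversal (fun i => G.switches col (hub i))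
    (fun i => span_switches_eq_top hcol (hC i) (hconn i) (hrow i)) (fun i => zero_mem_switches)
    (Γ.pairTrace id - G.pairTrace col)
  obtain ⟨l, -, hl⟩ := exists_localCompls_of_switches hcol hub hanti f hf Finset.univ
  rw [hsum, sub_left_inj] at hl
  have key : ∀ a b, a < b → ((G.localCompls l).Adj (col a) (col b) ↔ Γ.Adj a b) := by
    intro a b hab
    have := congrFun hl ⟨(a, b), hab⟩
    simp only [pairTrace, id] at this
    rw [← adjF2_eq_one, this, adjF2_eq_one]
  refine ⟨l, fun a b => ?_⟩
  rcases lt_trichotomy a b with h | rfl | h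
  · exact key a b h
  · simp
  · rw [adj_comm, key b a h, adj_comm]

end SimpleGraph

/-! ### Vertex-minors from local complementations and embeddings -/

namespace FiniteGraph

lemma IsVertexMinor.localCompls {G : FiniteGraph.{u}} {V : Type u} [Finite V]
    {g : SimpleGraph V} (h : IsVertexMinor G ⟨V, g⟩) (l : List V) :
    IsVertexMinor G ⟨V, g.localCompls l⟩ := by
  induction l generalizing g with
  | nil => exact h
  | cons v l ih => exact ih (h.localComplement v)

lemma IsVertexMinor.of_embedding {G K : FiniteGraph.{u}} (n : ℕ) : ∀ {H : FiniteGraph.{u}},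
    IsVertexMinor G H → Nat.card H.V = n → Nonempty (K.graph ↪g H.graph) → IsVertexMinor G K := by
  induction n using Nat.strong_induction_on with
  | _ n ih =>
    rintro H h hn ⟨e⟩
    by_cases hs : Function.Surjective e
    · exact h.iso (RelIso.ofSurjective e hs).symm
    · obtain ⟨v, hv⟩ := not_forall.1 hs
      have hcard : Nat.card (H.deleteVertex v).V < n := by
        rw [← hn]
        exact Finite.card_subtype_lt (p := fun w => w ≠ v) (x := v) (by simp)
      refine ih _ hcard (h.delete v) rfl ⟨⟨⟨fun x => ⟨e x, fun hx => hv ⟨x, hx⟩⟩, ?_⟩, ?_⟩⟩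
      · intro x y hxy
        exact e.injective (congrArg Subtype.val hxy)
      · intro x y
        exact e.map_rel_iff

/-- A graph that embeds into a graph locally equivalent to `G` is a vertex-minor of `G`. -/
lemma isVertexMinor_of_localCompls {G K : FiniteGraph.{u}} (l : List G.V)
    (e : K.graph ↪g G.graph.localCompls l) : IsVertexMinor G K :=
  IsVertexMinor.of_embedding _ (IsVertexMinor.refl.localCompls l) rfl ⟨e⟩

end FiniteGraph

/-! ### Ramsey's theorem for pairs -/

section Ramsey

variable {K : Type*} [Finite K]

/-- The colour of a pair is made to depend on its smaller element only: keep the minimum, restrict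
to its most frequent colour, and repeat. -/
lemma exists_strictMono_end_homogeneous [Nonempty K] (N : ℕ) : ∃ n : ℕ, ∀ {α : Type} [LinearOrder α]
    (s : Finset α) (f : α → α → K), n ≤ s.card → ∃ (g : Fin N → α) (φ : Fin N → K),
      StrictMono g ∧ (∀ a, g a ∈ s) ∧ ∀ a b, a < b → f (g a) (g b) = φ a := by
  classical
  have := Fintype.ofFinite K
  induction N with
  | zero =>
    exact ⟨0, fun s f _ => ⟨Fin.elim0, Fin.elim0, fun a => a.elim0, fun a => a.elim0,
      fun a => a.elim0⟩⟩
  | succ N ih =>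
    obtain ⟨n, hn⟩ := ih
    refine ⟨Fintype.card K * n + 1, fun s f hs => ?_⟩
    have hne : s.Nonempty := Finset.card_pos.1 (by omega)
    set t := s.min' hne
    have hcard : (Finset.univ : Finset K).card * n ≤ (s.erase t).card := by
      rw [Finset.card_erase_of_mem (s.min'_mem hne), Finset.card_univ]
      omega
    obtain ⟨κ, -, hκ⟩ := Finset.exists_le_card_fiber_of_mul_le_card_of_maps_to
      (f := f t) (fun a _ => Finset.mem_univ _) Finset.univ_nonempty hcard
    obtain ⟨g, φ, hg, hgs, hφ⟩ := hn _ f hκ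
    have hgs' : ∀ a, g a ∈ s ∧ t < g a ∧ f t (g a) = κ := by
      intro a
      have h1 := Finset.mem_filter.1 (hgs a)
      have h2 := Finset.mem_erase.1 h1.1
      exact ⟨h2.2, lt_of_le_of_ne (s.min'_le _ h2.2) h2.1.symm, h1.2⟩
    refine ⟨Fin.cons t g, Fin.cons κ φ, ?_, ?_, ?_⟩
    · intro a b hab
      induction b using Fin.cases with
      | zero => exact absurd hab (Fin.not_lt_zero _)
      | succ b =>
        induction a using Fin.cases with
        | zero => simpa using (hgs' b).2.1
        | succ a => simpa using hg (Fin.succ_lt_succ_iff.1 hab)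
    · intro a
      induction a using Fin.cases with
      | zero => simpa using s.min'_mem hne
      | succ a => simpa using (hgs' a).1
    · intro a b hab
      induction b using Fin.cases with
      | zero => exact absurd hab (Fin.not_lt_zero _)
      | succ b =>
        induction a using Fin.cases with
        | zero => simpa using (hgs' b).2.2
        | succ a => simpa using hφ a b (Fin.succ_lt_succ_iff.1 hab)

/-- The finite Ramsey theorem for pairs. -/
lemma exists_strictMono_homogeneous [Nonempty K] (N : ℕ) : ∃ n : ℕ, ∀ f : Fin n → Fin n → K,
    ∃ (g : Fin N → Fin n) (κ : K), StrictMono g ∧ ∀ a b, a < b → f (g a) (g b) = κ := by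
  classical
  have := Fintype.ofFinite K
  obtain ⟨n, hn⟩ := exists_strictMono_end_homogeneous (K := K) (Fintype.card K * N)
  refine ⟨n, fun f => ?_⟩
  obtain ⟨g, φ, hg, -, hφ⟩ := hn (Finset.univ : Finset (Fin n)) f (by simp)
  obtain ⟨κ, -, hκ⟩ := Finset.exists_le_card_fiber_of_mul_le_card_of_maps_to
    (s := (Finset.univ : Finset (Fin (Fintype.card K * N)))) (t := (Finset.univ : Finset K))
    (f := φ) (n := N) (fun a _ => Finset.mem_univ _) Finset.univ_nonempty (by simp)
  obtain ⟨s, hs, hcard⟩ := Finset.exists_subset_card_eq hκ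
  refine ⟨fun a => g (s.orderEmbOfFin hcard a), κ,
    hg.comp (s.orderEmbOfFin hcard).strictMono, fun a b hab => ?_⟩
  rw [hφ _ _ ((s.orderEmbOfFin hcard).strictMono hab)]
  exact (Finset.mem_filter.1 (hs (s.orderEmbOfFin_mem hcard a))).2

end Ramsey

/-! ### Hubs from distance layers, and vertices far apart -/

namespace SimpleGraph

variable {V : Type*} {G : SimpleGraph V}

/-- The subgraph induced on `S` has a proper colouring with `k` colours. -/
def ColorableOn (G : SimpleGraph V) (S : Set V) (k : ℕ) : Prop :=
  ∃ f : V → ℕ, (∀ x ∈ S, f x < k) ∧ ∀ x ∈ S, ∀ y ∈ S, G.Adj x y → f x ≠ f y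

lemma ColorableOn.mono {S T : Set V} {k l : ℕ} (h : G.ColorableOn T l) (hST : S ⊆ T)
    (hkl : l ≤ k) : G.ColorableOn S k := by
  obtain ⟨f, h1, h2⟩ := h
  exact ⟨f, fun x hx => (h1 x (hST hx)).trans_le hkl, fun x hx y hy => h2 x (hST hx) y (hST hy)⟩

lemma ColorableOn.union {S T : Set V} {k l : ℕ} (h : G.ColorableOn S k)
    (h' : G.ColorableOn T l) : G.ColorableOn (S ∪ T) (k + l) := by
  classical
  obtain ⟨f, h1, h2⟩ := h
  obtain ⟨f', h1', h2'⟩ := h'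
  refine ⟨fun x => if x ∈ S then f x else k + f' x, ?_, ?_⟩
  · intro x hx
    by_cases hS : x ∈ S
    · have := h1 x hS
      simp only [hS, if_true]
      omega
    · have := h1' x (hx.resolve_left hS)
      simp only [hS, if_false]
      omega
  · intro x hx y hy hxy
    by_cases hxS : x ∈ S <;> by_cases hyS : y ∈ S <;> simp only [hxS, hyS, if_true, if_false]
    · exact h2 x hxS y hyS hxy
    · have := h1 x hxS
      omega
    · have := h1 y hyS
      omega
    · have := h2' x (hx.resolve_left hxS) y (hy.resolve_left hyS) hxy
      omega

lemma ColorableOn.empty (k : ℕ) : G.ColorableOn ∅ k :=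
  ⟨fun _ => 0, by simp, by simp⟩

/-- One of the distance layers of an induced subgraph carries half of its chromatic number. -/
lemma exists_layer_not_colorableOn {S : Set V} {k : ℕ} (hS : ¬ G.ColorableOn S (2 * k)) :
    ∃ v t, ¬ G.ColorableOn
      {x | x ∈ S ∧ (G.restrict S).Reachable v x ∧ (G.restrict S).dist v x = t} k := by
  by_contra! hcon
  choose φ h1 h2 using hcon
  set root : V → V := fun x => Quot.out ((G.restrict S).connectedComponentMk x) with hroot
  have hr : ∀ x, (G.restrict S).Reachable (root x) x := fun x =>
    ConnectedComponent.exact (Quot.out_eq ((G.restrict S).connectedComponentMk x))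
  -- Layers of adjacent vertices differ by at most one, so the parity of the distance separates
  -- distinct layers at the cost of a factor 2.
  refine hS ⟨fun x => 2 * φ (root x) ((G.restrict S).dist (root x) x) x +
    (G.restrict S).dist (root x) x % 2, ?_, ?_⟩
  · intro x hx
    have := h1 (root x) _ x ⟨hx, hr x, rfl⟩
    simp only
    omega
  · intro x hx y hy hxy heq
    have hadj : (G.restrict S).Adj x y := ⟨hxy, hx, hy⟩
    have hxyr : root x = root y := by
      simp only [hroot, ConnectedComponent.sound hadj.reachable]
    have hd1 := dist_le_dist_add_one (hr x) hadj
    have hd2 := dist_le_dist_add_one (hr y) hadj.symm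
    simp only [hxyr] at heq hd1 hd2
    have hd : (G.restrict S).dist (root y) x = (G.restrict S).dist (root y) y := by omega
    refine h2 (root y) _ x ⟨hx, hxyr ▸ hr x, hd⟩ y ⟨hy, hr y, rfl⟩ hxy ?_
    rw [hd] at heq
    omega

lemma exists_hub_layer {b k : ℕ} (hball : ∀ v, G.ColorableOn {w | G.edist v w ≤ 9} b)
    (hbk : b ≤ k) {S : Set V} (hS : ¬ G.ColorableOn S (2 * k)) :
    ∃ H T : Set V, T ⊆ S ∧ H ⊆ S ∧ (∀ u ∈ H, ∀ w ∈ H, (G.restrict H).Reachable u w) ∧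
      ¬ G.ColorableOn T k ∧ (∀ x ∈ T, ∀ h ∈ H, x ≠ h ∧ ¬ G.Adj x h) ∧
      ∀ x ∈ T, ∃ p ∈ S, G.Adj x p ∧ ∃ h ∈ H, G.Adj p h := by
  obtain ⟨v, t, hT⟩ := exists_layer_not_colorableOn hS
  -- Layers 0 and 1 lie in a ball, hence are too easy to colour.
  have ht : 2 ≤ t := by
    by_contra! hlt
    refine hT ((hball v).mono (fun x hx => ?_) hbk)
    obtain ⟨-, hr, hd⟩ := hx
    have : G.edist v x ≤ 1 := by
      obtain ht | ht : t = 0 ∨ t = 1 := by omega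
      · rw [ht, hr.dist_eq_zero_iff] at hd
        simp [hd]
      · rw [ht, dist_eq_one_iff_adj] at hd
        rw [edist_eq_one_iff_adj.2 hd.1]
    exact this.trans (by norm_num)
  set R := G.restrict S with hR
  -- Stopping at `t - 2` leaves layer `t - 1` between hub and target, which makes them anticomplete
  -- and supplies the joining vertices. Reachability is recorded because `dist` is 0 between
  -- components.
  set H : Set V := {y | y ∈ S ∧ R.Reachable v y ∧ R.dist v y ≤ t - 2} with hH
  have hconn : ∀ n, ∀ u ∈ H, R.dist v u = n → (G.restrict H).Reachable v u := by
    intro n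
    induction n with
    | zero =>
      intro u hu hd
      rw [hu.2.1.dist_eq_zero_iff.1 hd]
    | succ n ih =>
      intro u hu hd
      obtain ⟨y, hyu, hry, hdy⟩ := exists_adj_of_dist_eq_succ hu.2.1 hd
      have hy : y ∈ H := ⟨hyu.2.1, hry, by have := hu.2.2; omega⟩
      exact (ih y hy hdy).trans (Adj.reachable ⟨hyu.1, hy, hu⟩)
  refine ⟨H, _, fun x hx => hx.1, fun x hx => hx.1,
    fun u hu w hw => (hconn _ u hu rfl).symm.trans (hconn _ w hw rfl), hT, ?_, ?_⟩
  · rintro x ⟨hxS, hrx, hdx⟩ h ⟨hhS, hrh, hdh⟩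
    refine ⟨fun he => ?_, fun ha => ?_⟩
    · subst he
      omega
    · have := dist_le_dist_add_one (G := R) hrh ⟨ha.symm, hhS, hxS⟩
      omega
  · rintro x ⟨hxS, hrx, hdx⟩
    obtain ⟨p, hpx, hrp, hdp⟩ := exists_adj_of_dist_eq_succ (n := t - 1) hrx (by omega)
    obtain ⟨h, hhp, hrh, hdh⟩ := exists_adj_of_dist_eq_succ (n := t - 2) hrp (by omega)
    exact ⟨p, hpx.2.1, hpx.1.symm, h, ⟨hhp.2.1, hrh, hdh.le⟩, hhp.1.symm⟩

/-- Pairwise anticomplete connected hubs `H i` inside `S`, together with a set `T` anticomplete to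
them all and, for each vertex `x` of `T` and each hub, a vertex `p i x` that joins `x` to `H i` and
has no neighbour in earlier hubs. -/
structure IsHubSystem (G : SimpleGraph V) {n : ℕ} (S T : Set V) (H : Fin n → Set V)
    (p : Fin n → V → V) : Prop where
  subset : T ⊆ S
  hub_subset : ∀ i, H i ⊆ S
  par_mem : ∀ i, ∀ x ∈ T, p i x ∈ S
  connected : ∀ i, ∀ u ∈ H i, ∀ w ∈ H i, (G.restrict (H i)).Reachable u w
  anticomplete : ∀ i k, i ≠ k → ∀ u ∈ H i, ∀ w ∈ H k, u ≠ w ∧ ¬ G.Adj u w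
  anticomplete_target : ∀ i, ∀ x ∈ T, ∀ u ∈ H i, x ≠ u ∧ ¬ G.Adj x u
  adj_par : ∀ i, ∀ x ∈ T, G.Adj x (p i x)
  par_adj : ∀ i, ∀ x ∈ T, ∃ h ∈ H i, G.Adj (p i x) h
  not_par_adj : ∀ i c, c < i → ∀ x ∈ T, ∀ u ∈ H c, ¬ G.Adj (p i x) u

/-- Each round works inside the previous target layer and halves the bound. Later hubs and joining
vertices therefore avoid earlier hubs, whereas earlier joining vertices may still meet later hubs.
-/
lemma exists_isHubSystem {b : ℕ} (hball : ∀ v, G.ColorableOn {w | G.edist v w ≤ 9} b) {k : ℕ}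
    (hbk : b ≤ k) (n : ℕ) : ∀ S : Set V, ¬ G.ColorableOn S (2 ^ n * k) →
      ∃ (T : Set V) (H : Fin n → Set V) (p : Fin n → V → V),
        G.IsHubSystem S T H p ∧ ¬ G.ColorableOn T k := by
  induction n with
  | zero =>
    intro S hS
    refine ⟨S, Fin.elim0, Fin.elim0, ⟨subset_rfl, ?_, ?_, ?_, ?_, ?_, ?_, ?_, ?_⟩, by simpa using hS⟩
    all_goals exact fun i => i.elim0
  | succ n ih =>
    intro S hS
    rw [pow_succ', mul_assoc] at hS
    obtain ⟨H₀, S', hS'S, hH₀S, hconn, hS', hanti, hpar⟩ := exists_hub_layer hball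
      (hbk.trans (Nat.le_mul_of_pos_left k (by positivity))) hS
    choose! p₀ hp₀S hxp₀ hp₀H using hpar
    obtain ⟨T, H, p, hsys, hT⟩ := ih S' hS'
    refine ⟨T, Fin.cons H₀ H, Fin.cons p₀ p, ⟨hsys.subset.trans hS'S, ?_, ?_, ?_, ?_, ?_, ?_, ?_,
      ?_⟩, hT⟩
    · intro i
      induction i using Fin.cases with
      | zero => exact hH₀S
      | succ i => exact (hsys.hub_subset i).trans hS'S
    · intro i x hx
      induction i using Fin.cases with
      | zero => exact hp₀S x (hsys.subset hx)
      | succ i => exact hS'S (hsys.par_mem i x hx)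
    · intro i
      induction i using Fin.cases with
      | zero => exact hconn
      | succ i => exact hsys.connected i
    · intro i k hik u hu w hw
      induction i using Fin.cases with
      | zero =>
        induction k using Fin.cases with
        | zero => exact absurd rfl hik
        | succ k =>
          have := hanti w (hsys.hub_subset k hw) u hu
          exact ⟨this.1.symm, fun h => this.2 h.symm⟩
      | succ i =>
        induction k using Fin.cases with
        | zero => exact hanti u (hsys.hub_subset i hu) w hw
        | succ k => exact hsys.anticomplete i k (fun h => hik (by rw [h])) u hu w hw
    · intro i x hx u hu
      induction i using Fin.cases with
      | zero => exact hanti x (hsys.subset hx) u hu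
      | succ i => exact hsys.anticomplete_target i x hx u hu
    · intro i x hx
      induction i using Fin.cases with
      | zero => exact hxp₀ x (hsys.subset hx)
      | succ i => exact hsys.adj_par i x hx
    · intro i x hx
      induction i using Fin.cases with
      | zero => exact hp₀H x (hsys.subset hx)
      | succ i => exact hsys.par_adj i x hx
    · intro i c hci x hx u hu
      induction i using Fin.cases with
      | zero => exact absurd hci (Fin.not_lt_zero _)
      | succ i =>
        induction c using Fin.cases with
        | zero => exact (hanti _ (hsys.par_mem i x hx) u hu).2
        | succ c => exact hsys.not_par_adj i c (Fin.succ_lt_succ_iff.1 hci) x hx u hu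

lemma IsHubSystem.par_notMem {n : ℕ} {S T : Set V} {H : Fin n → Set V} {p : Fin n → V → V}
    (h : G.IsHubSystem S T H p) (i c : Fin n) {x : V} (hx : x ∈ T) : p i x ∉ H c := fun hp =>
  (h.anticomplete_target c x hx _ hp).2 (h.adj_par i x hx)

/-- A set of large chromatic number contains many vertices that are pairwise far apart. -/
lemma exists_far_vertices {b : ℕ} (hball : ∀ v, G.ColorableOn {w | G.edist v w ≤ 9} b) (m : ℕ) :
    ∀ S : Set V, ¬ G.ColorableOn S (m * b) → ∃ x : Fin m → V, (∀ i, x i ∈ S) ∧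
      ∀ i j, i ≠ j → ¬ G.edist (x i) (x j) ≤ 9 := by
  induction m with
  | zero => exact fun S _ => ⟨Fin.elim0, fun i => i.elim0, fun i => i.elim0⟩
  | succ m ih =>
    intro S hS
    obtain ⟨y, hy⟩ : S.Nonempty := by
      rw [Set.nonempty_iff_ne_empty]
      rintro rfl
      exact hS (ColorableOn.empty _)
    obtain ⟨x, hxS, hx⟩ := ih (S \ {w | G.edist y w ≤ 9}) (fun h => hS <| by
      refine (h.union (hball y)).mono (fun z hz => ?_) (by rw [add_mul, one_mul])
      by_cases hzb : z ∈ {w | G.edist y w ≤ 9}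
      · exact Or.inr hzb
      · exact Or.inl ⟨hz, hzb⟩)
    refine ⟨Fin.cons y x, fun i => ?_, fun i j hij => ?_⟩
    · induction i using Fin.cases with
      | zero => simpa using hy
      | succ i => simpa using (hxS i).1
    · induction i using Fin.cases with
      | zero =>
        induction j using Fin.cases with
        | zero => exact absurd rfl hij
        | succ j => exact (hxS j).2
      | succ i =>
        induction j using Fin.cases with
        | zero =>
          have := (hxS i).2
          simp only [Set.mem_ofPred_eq, Fin.cons_succ, Fin.cons_zero] at this ⊢
          rwa [edist_comm]
        | succ j => exact hx i j (fun h => hij (by rw [h]))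

end SimpleGraph

/-! ### Choosing the columns -/

namespace SimpleGraph

variable {V : Type*} {G : SimpleGraph V}

/-- The effect of local complementations at pairwise nonadjacent vertices. -/
lemma adjF2_localCompls_of_stable (l : List V) : ∀ {G : SimpleGraph V},
    (∀ v ∈ l, ∀ w ∈ l, ¬ G.Adj v w) → ∀ {a b : V}, a ≠ b →
    (G.localCompls l).adjF2 a b = G.adjF2 a b + (l.map fun v => G.adjF2 v a * G.adjF2 v b).sum := by
  induction l with
  | nil => intros; simp
  | cons v l ih =>
    intro G hl a b hab
    have hrow : ∀ w ∈ l, ∀ y, (G.localCompl v).adjF2 w y = G.adjF2 w y := by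
      intro w hw y
      by_cases hwy : w = y
      · simp [hwy, adjF2_self]
      · rw [adjF2_localCompl _ _ hwy, adjF2_of_not_adj (hl v (by simp) w (by simp [hw])),
          zero_mul, add_zero]
    rw [localCompls_cons, ih (fun w hw z hz => ?_) hab, adjF2_localCompl _ _ hab, List.map_cons,
      List.sum_cons, add_assoc, List.map_congr_left fun w hw => ?_]
    · rw [hrow w hw, hrow w hw]
    · rw [← adjF2_eq_zero, hrow w hw, adjF2_eq_zero]
      exact hl w (by simp [hw]) z (by simp [hz])

lemma restrict_mono {G G' : SimpleGraph V} {C D : Set V} (hCD : C ⊆ D)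
    (h : ∀ u ∈ C, ∀ y, G'.Adj u y ↔ G.Adj u y) : G.restrict C ≤ G'.restrict D :=
  fun _ _ ha => ⟨(h _ ha.2.1 _).2 ha.1, hCD ha.2.1, hCD ha.2.2⟩

section Columns

variable {n r : ℕ} {S T : Set V} {H : Fin n → Set V} {p : Fin n → V → V} {x : Fin r → V}

/-- The columns are the joining vertices of one hub, if these meet all the other hubs. -/
lemma IsHubSystem.exists_localCompls_of_touching (hsys : G.IsHubSystem S T H p)
    (hxT : ∀ j, x j ∈ T) (hfar : ∀ i j, i ≠ j → ¬ G.edist (x i) (x j) ≤ 9)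
    (i₀ : Fin n) (g : Fin (Module.finrank (ZMod 2) (PairSpace (Fin r))) → Fin n)
    (hg : Function.Injective g)
    (htouch : ∀ i j, ∃ h ∈ H (g i), G.Adj (p i₀ (x j)) h) (Γ : SimpleGraph (Fin r)) :
    ∃ (l : List V) (col : Fin r → V), Function.Injective col ∧
      ∀ a b, (G.localCompls l).Adj (col a) (col b) ↔ Γ.Adj a b := by
  have hwalk : ∀ {i j} (w : G.Walk (x i) (x j)), w.length ≤ 9 → i = j := by
    intro i j w hw
    by_contra hij
    exact hfar i j hij (w.edist_le.trans (by exact_mod_cast hw))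
  have hxp : ∀ j, G.Adj (x j) (p i₀ (x j)) := fun j => hsys.adj_par i₀ _ (hxT j)
  have hcol : Function.Injective fun j => p i₀ (x j) := by
    intro i j hij
    have h1 := hxp i
    simp only at hij
    rw [hij] at h1
    exact hwalk (.cons h1 (.cons (hxp j).symm .nil)) (by simp)
  obtain ⟨l, hl⟩ := exists_localCompls_adj_iff (G := G) hcol (fun i => H (g i))
    (fun i k hik u hu w hw => (hsys.anticomplete _ _ (hg.ne hik) u hu w hw).2)
    (fun i u hu a he => hsys.par_notMem i₀ (g i) (hxT a) (he ▸ hu))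
    (fun i => hsys.connected _) (fun i a => by
      obtain ⟨h, hh, hadj⟩ := htouch i a
      refine ⟨h, hh, fun b => ⟨fun hb => ?_, ?_⟩⟩
      -- A second column at `h` gives a walk of length 4 between two far vertices. No longer walk is
      -- needed in the proof, so the distance 9 leaves slack.
      · exact hwalk (.cons (hxp b) (.cons hb.symm (.cons hadj.symm (.cons (hxp a).symm .nil))))
          (by simp)
      · rintro rfl
        exact hadj.symm) Γ
  exact ⟨l, _, hcol, hl⟩

/-- The columns are the target vertices, if the joining vertices meet no other hub and, after
changes of adjacency among the joining vertices, are pairwise nonadjacent. -/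
lemma IsHubSystem.exists_localCompls_of_not_touching (hsys : G.IsHubSystem S T H p)
    (hxT : ∀ j, x j ∈ T) (hfar : ∀ i j, i ≠ j → ¬ G.edist (x i) (x j) ≤ 9)
    (g : Fin (Module.finrank (ZMod 2) (PairSpace (Fin r))) → Fin n) (hg : StrictMono g)
    (hnot : ∀ i k, i < k → ∀ j, ∀ h ∈ H (g k), ¬ G.Adj (p (g i) (x j)) h)
    {G' : SimpleGraph V} (hH : ∀ i, ∀ u ∈ H i, ∀ y, G'.Adj u y ↔ G.Adj u y)
    (hx : ∀ j y, G'.Adj (x j) y ↔ G.Adj (x j) y)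
    (hp : ∀ i k, i ≠ k → ∀ a b, ¬ G'.Adj (p (g i) (x a)) (p (g k) (x b)))
    (Γ : SimpleGraph (Fin r)) :
    ∃ l : List V, ∀ a b, (G'.localCompls l).Adj (x a) (x b) ↔ Γ.Adj a b := by
  have hwalk : ∀ {i j} (w : G.Walk (x i) (x j)), w.length ≤ 9 → i = j := by
    intro i j w hw
    by_contra hij
    exact hfar i j hij (w.edist_le.trans (by exact_mod_cast hw))
  have hinj : Function.Injective x := by
    intro i j hij
    by_contra hne
    exact hfar i j hne (by simp [hij])
  have hpH : ∀ i k, i ≠ k → ∀ j, ∀ h ∈ H (g k), ¬ G'.Adj (p (g i) (x j)) h := by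
    intro i k hik j h hh
    rw [adj_comm, hH _ h hh, adj_comm]
    rcases lt_or_gt_of_ne hik with hlt | hlt
    · exact hnot i k hlt j h hh
    · exact hsys.not_par_adj _ _ (hg hlt) _ (hxT j) h hh
  -- The target vertices have no neighbours in the original hubs, so each hub is enlarged by its
  -- joining vertices, which serve as the private neighbours.
  refine exists_localCompls_adj_iff hinj (fun i => H (g i) ∪ Set.range fun j => p (g i) (x j))
    ?_ ?_ ?_ ?_ Γ
  · rintro i k hik u (hu | ⟨a, rfl⟩) w (hw | ⟨b, rfl⟩)
    · rw [hH _ u hu]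
      exact (hsys.anticomplete _ _ (hg.injective.ne hik) u hu w hw).2
    · exact fun h => hpH k i hik.symm b u hu h.symm
    · exact hpH i k hik a w hw
    · exact hp i k hik a b
  · rintro i u (hu | ⟨b, rfl⟩) a he
    · exact (hsys.anticomplete_target _ _ (hxT a) u hu).1 he.symm
    · obtain ⟨h, hh, hadj⟩ := hsys.par_adj (g i) _ (hxT b)
      simp only at he
      rw [he] at hadj
      exact (hsys.anticomplete_target _ _ (hxT a) h hh).2 hadj
  · intro i
    set D : Set V := H (g i) ∪ Set.range fun j => p (g i) (x j) with hD
    have hroot : ∀ u ∈ D, ∃ h ∈ H (g i), (G'.restrict D).Reachable u h := by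
      rintro u (hu | ⟨b, rfl⟩)
      · exact ⟨u, hu, .rfl⟩
      · obtain ⟨h, hh, hadj⟩ := hsys.par_adj (g i) _ (hxT b)
        exact ⟨h, hh, Adj.reachable ⟨((hH _ h hh _).2 hadj.symm).symm, Or.inr ⟨b, rfl⟩, Or.inl hh⟩⟩
    intro u hu w hw
    obtain ⟨h, hh, hr⟩ := hroot u hu
    obtain ⟨h', hh', hr'⟩ := hroot w hw
    exact hr.trans (((hsys.connected (g i) h hh h' hh').mono
      (restrict_mono Set.subset_union_left (hH (g i)))).trans hr'.symm)
  · intro i a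
    refine ⟨p (g i) (x a), Or.inr ⟨a, rfl⟩, fun b => ?_⟩
    have hxa := hsys.adj_par (g i) _ (hxT a)
    rw [adj_comm, hx]
    refine ⟨fun h => hwalk (.cons h (.cons hxa.symm .nil)) (by simp), ?_⟩
    rintro rfl
    exact hxa

/-- `κ.1` decides whether joining vertices meet later hubs, `κ.2` whether the joining vertices of
one target are pairwise adjacent. The extra index of `g` provides the column hub in the touching
case. -/
lemma IsHubSystem.exists_localCompls (hsys : G.IsHubSystem S T H p)
    (hxT : ∀ j, x j ∈ T) (hfar : ∀ i j, i ≠ j → ¬ G.edist (x i) (x j) ≤ 9)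
    (g : Fin (Module.finrank (ZMod 2) (PairSpace (Fin r)) + 1) → Fin n) (hg : StrictMono g)
    (κ : Prop × Prop)
    (hκ : ∀ i k, i < k → ∀ j, ((∃ h ∈ H (g k), G.Adj (p (g i) (x j)) h) ↔ κ.1) ∧
      (G.Adj (p (g i) (x j)) (p (g k) (x j)) ↔ κ.2)) (Γ : SimpleGraph (Fin r)) :
    ∃ (l : List V) (col : Fin r → V), Function.Injective col ∧
      ∀ a b, (G.localCompls l).Adj (col a) (col b) ↔ Γ.Adj a b := by
  by_cases h1 : κ.1
  · exact hsys.exists_localCompls_of_touching hxT hfar (g 0) (fun i => g i.succ)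
      (hg.injective.comp (Fin.succ_injective _))
      (fun i j => (hκ 0 i.succ (Fin.succ_pos i) j).1.2 h1) Γ
  have hwalk : ∀ {i j} (w : G.Walk (x i) (x j)), w.length ≤ 9 → i = j := by
    intro i j w hw
    by_contra hij
    exact hfar i j hij (w.edist_le.trans (by exact_mod_cast hw))
  have hinj : Function.Injective x := by
    intro i j hij
    by_contra hne
    exact hfar i j hne (by simp [hij])
  have hxp : ∀ i j, G.Adj (x j) (p i (x j)) := fun i j => hsys.adj_par i _ (hxT j)
  have hg' : StrictMono fun i : Fin (Module.finrank (ZMod 2) (PairSpace (Fin r))) =>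
      g i.castSucc := fun i k hik => hg (Fin.castSucc_lt_castSucc_iff.2 hik)
  have hnot : ∀ i k : Fin (Module.finrank (ZMod 2) (PairSpace (Fin r))), i < k → ∀ j,
      ∀ h ∈ H (g k.castSucc), ¬ G.Adj (p (g i.castSucc) (x j)) h := fun i k hik j h hh ha =>
    h1 ((hκ _ _ (Fin.castSucc_lt_castSucc_iff.2 hik) j).1.1 ⟨h, hh, ha⟩)
  have hadj : ∀ i k : Fin (Module.finrank (ZMod 2) (PairSpace (Fin r))), i ≠ k → ∀ j,
      (G.Adj (p (g i.castSucc) (x j)) (p (g k.castSucc) (x j)) ↔ κ.2) := by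
    intro i k hik j
    rcases lt_or_gt_of_ne hik with h | h
    · exact (hκ _ _ (Fin.castSucc_lt_castSucc_iff.2 h) j).2
    · rw [adj_comm]
      exact (hκ _ _ (Fin.castSucc_lt_castSucc_iff.2 h) j).2
  have hdist : ∀ i k a b, G.Adj (p i (x a)) (p k (x b)) → a = b := fun i k a b h =>
    hwalk (.cons (hxp i a) (.cons h (.cons (hxp k b).symm .nil))) (by simp)
  -- Complementing at all targets removes the edges between joining vertices of a common target and
  -- leaves the rows of hubs and targets unchanged.
  by_cases h2 : κ.2
  · have hstab : ∀ a b, ¬ G.Adj (x a) (x b) := fun a b h => by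
      obtain rfl := hwalk (.cons h .nil) (by simp)
      exact h.ne rfl
    have hstab' : ∀ v ∈ List.ofFn x, ∀ w ∈ List.ofFn x, ¬ G.Adj v w := by
      intro v hv w hw
      obtain ⟨a, rfl⟩ := (List.mem_ofFn' x v).1 hv
      obtain ⟨b, rfl⟩ := (List.mem_ofFn' x w).1 hw
      exact hstab a b
    have hxpa : ∀ i a b, G.Adj (x a) (p i (x b)) ↔ a = b := by
      intro i a b
      refine ⟨fun h => hwalk (.cons h (.cons (hxp i b).symm .nil)) (by simp), ?_⟩
      rintro rfl
      exact hxp i a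
    have hH := localCompls_adj_of_anticomplete (G := G) (D := ⋃ i, H i) (List.ofFn x) (by
      intro v hv u hu
      obtain ⟨a, rfl⟩ := (List.mem_ofFn' x v).1 hv
      obtain ⟨i, hi⟩ := Set.mem_iUnion.1 hu
      exact (hsys.anticomplete_target i _ (hxT a) u hi).2)
    have hX := localCompls_adj_of_anticomplete (G := G) (D := Set.range x) (List.ofFn x) (by
      rintro v hv _ ⟨b, rfl⟩
      obtain ⟨a, rfl⟩ := (List.mem_ofFn' x v).1 hv
      exact hstab a b)
    obtain ⟨l, hl⟩ := hsys.exists_localCompls_of_not_touching hxT hfar _ hg' hnot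
      (G' := G.localCompls (List.ofFn x))
      (fun i u hu y => hH u (Set.mem_iUnion.2 ⟨i, hu⟩) y) (fun j y => hX _ ⟨j, rfl⟩ y)
      (fun i k hik a b => by
        by_cases hpp : p (g i.castSucc) (x a) = p (g k.castSucc) (x b)
        · rw [hpp]
          exact fun h => h.ne rfl
        rw [← adjF2_eq_zero, adjF2_localCompls_of_stable _ hstab' hpp, List.map_ofFn,
          List.sum_ofFn]
        simp only [Function.comp_apply]
        -- Only a target adjacent to both joining vertices contributes to the sum: this is `x a` if
        -- `a = b`, cancelling the existing edge, and none otherwise.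
        by_cases hab : a = b
        · subst hab
          rw [adjF2_of_adj ((hadj i k hik a).2 h2), Finset.sum_eq_single a, adjF2_of_adj (hxp _ a),
            adjF2_of_adj (hxp _ a)]
          · decide
          · intro c _ hc
            rw [adjF2_of_not_adj (mt (hxpa _ c a).1 hc), zero_mul]
          · simp
        · rw [adjF2_of_not_adj (fun h => hab (hdist _ _ a b h)), zero_add]
          refine Finset.sum_eq_zero fun c _ => ?_
          by_cases hca : c = a
          · rw [adjF2_of_not_adj (mt (hxpa (g k.castSucc) c b).1 (by rwa [hca])), mul_zero]
          · rw [adjF2_of_not_adj (mt (hxpa _ c a).1 hca), zero_mul]) Γ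
    exact ⟨_, x, hinj, by rwa [← localCompls_append] at hl⟩
  · obtain ⟨l, hl⟩ := hsys.exists_localCompls_of_not_touching hxT hfar _ hg' hnot (G' := G)
      (fun _ _ _ _ => Iff.rfl) (fun _ _ => Iff.rfl)
      (fun i k hik a b h => by
        obtain rfl := hdist _ _ a b h
        exact h2 ((hadj i k hik a).1 h)) Γ
    exact ⟨l, x, hinj, hl⟩

end Columns

/-- A graph whose chromatic number is large compared with that of its balls of radius `9` is
locally equivalent to a graph with a prescribed induced subgraph. -/
theorem exists_localCompls_of_not_colorableOn {r : ℕ} (Γ : SimpleGraph (Fin r)) :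
    ∃ c : ℕ, ∀ {V : Type*} (G : SimpleGraph V) (b : ℕ),
      (∀ v, G.ColorableOn {w | G.edist v w ≤ 9} b) → ¬ G.ColorableOn Set.univ (c * b) →
      ∃ (l : List V) (col : Fin r → V), Function.Injective col ∧
        ∀ a b, (G.localCompls l).Adj (col a) (col b) ↔ Γ.Adj a b := by
  classical
  obtain ⟨n, hn⟩ := exists_strictMono_homogeneous (K := Prop × Prop)
    (Module.finrank (ZMod 2) (PairSpace (Fin r)) + 1)
  set q := Fintype.card (Fin n → Fin n → Prop × Prop) with hq
  -- `2 ^ n` pays for `n` layers and `q * r` far vertices give `r` with the same pattern. The `+ 1`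
  -- keeps the factor positive, so that `b` is at most the remaining bound.
  refine ⟨2 ^ n * (q * r + 1), fun {V} G b hball hG => ?_⟩
  rw [mul_assoc] at hG
  obtain ⟨T, H, p, hsys, hT⟩ := exists_isHubSystem hball
    (Nat.le_mul_of_pos_left b (Nat.succ_pos (q * r))) n _ hG
  obtain ⟨y, hyT, hy⟩ := exists_far_vertices hball _ _ hT
  obtain ⟨f, -, hf⟩ := Finset.exists_le_card_fiber_of_mul_le_card_of_maps_to
    (s := (Finset.univ : Finset (Fin (q * r + 1))))
    (t := (Finset.univ : Finset (Fin n → Fin n → Prop × Prop)))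
    (f := fun j i k => (∃ h ∈ H k, G.Adj (p i (y j)) h, G.Adj (p i (y j)) (p k (y j)))) (n := r)
    (fun a _ => Finset.mem_univ _) ⟨fun _ _ => (True, True), Finset.mem_univ _⟩
    (by rw [Finset.card_univ, ← hq, Finset.card_univ, Fintype.card_fin]; omega)
  obtain ⟨s, hs, hcard⟩ := Finset.exists_subset_card_eq hf
  obtain ⟨g, κ, hg, hκ⟩ := hn f
  refine hsys.exists_localCompls (x := fun j => y (s.orderEmbOfFin hcard j)) (fun j => hyT _)
    (fun i j hij => hy _ _ ((s.orderEmbOfFin hcard).injective.ne hij)) g hg κ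
    (fun i k hik j => ?_) Γ
  have h1 := (Finset.mem_filter.1 (hs (s.orderEmbOfFin_mem hcard j))).2
  have h2 := hκ i k hik
  rw [← h1] at h2
  rw [← h2]
  exact ⟨Iff.rfl, Iff.rfl⟩

lemma ColorableOn.of_induce {S : Set V} {k : ℕ} (h : (G.induce S).Colorable k) :
    G.ColorableOn S k := by
  classical
  obtain ⟨C⟩ := h
  refine ⟨fun x => if hx : x ∈ S then C ⟨x, hx⟩ else 0, fun x hx => ?_, fun x hx y hy hxy => ?_⟩
  · simp [hx]
  · have := C.valid (v := ⟨x, hx⟩) (w := ⟨y, hy⟩) hxy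
    simpa [hx, hy, Fin.ext_iff] using this

lemma ColorableOn.colorable {k : ℕ} (h : G.ColorableOn Set.univ k) : G.Colorable k := by
  obtain ⟨f, h1, h2⟩ := h
  exact ⟨Coloring.mk (fun x => (⟨f x, h1 x trivial⟩ : Fin k))
    (fun {x y} hxy he => h2 x trivial y trivial hxy (congrArg Fin.val he))⟩

end SimpleGraph

theorem theorem2 (𝒢 : Set FiniteGraph.{u}) (hproper : FiniteGraph.Proper 𝒢)
    (hclosed : FiniteGraph.VertexMinorClosed 𝒢) :
    FiniteGraph.LinearlyControlled 9 𝒢 := by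
  obtain ⟨K, hK⟩ := hproper
  let e := Finite.equivFin K.V
  obtain ⟨c, hc⟩ := SimpleGraph.exists_localCompls_of_not_colorableOn (K.graph.map e.toEmbedding)
  refine ⟨c, fun G hG => ?_⟩
  have hball : ∀ v, (G.graph.induce (G.ballSet 9 v)).chromaticNumber ≤ G.ballChi 9 :=
    fun v => le_iSup (fun v => (G.graph.induce (G.ballSet 9 v)).chromaticNumber) v
  have hfin : G.ballChi 9 ≠ ⊤ := by
    have := Fintype.ofFinite G.V
    have hle : G.ballChi 9 ≤ (Fintype.card G.V : ℕ∞) := iSup_le fun v =>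
      SimpleGraph.Colorable.chromaticNumber_le
        (G.graph.colorable_of_fintype.of_hom (SimpleGraph.Embedding.induce _).toHom)
    exact ne_top_of_le_ne_top (ENat.natCast_ne_top _) hle
  obtain ⟨b, hb⟩ := ENat.ne_top_iff_exists.1 hfin
  have hballs : ∀ v, G.graph.ColorableOn {w | G.graph.edist v w ≤ 9} b := fun v =>
    SimpleGraph.ColorableOn.of_induce
      (SimpleGraph.chromaticNumber_le_iff_colorable.1 (by rw [hb]; exact hball v))
  by_cases hcol : G.graph.ColorableOn Set.univ (c * b)
  · rw [← hb]
    exact_mod_cast hcol.colorable.chromaticNumber_le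
  · obtain ⟨l, col, hinj, hadj⟩ := hc G.graph b hballs hcol
    refine absurd (hclosed G hG K (FiniteGraph.isVertexMinor_of_localCompls l
      ⟨e.toEmbedding.trans ⟨col, hinj⟩, ?_⟩)) hK
    intro x y
    exact (hadj _ _).trans (SimpleGraph.map_adj_apply (f := e.toEmbedding))
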